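/- Let $0<q<1$. Write $(a;q)_n=\prod_{i=0}^{n-1}(1-aq^i)$ and $(a;q)_\infty=\prod_{i\ge 0}(1-aq^i)$, $[n]_q=\frac{1-q^n}{1-q}$, $[n]_q!=\prod_{i=1}^n[i]_q$, and let $$e_q(t)=\sum_{n\ge 0}\frac{(t(1-q))^n}{(q;q)_n},\qquad E_q(t)=\sum_{n\ge 0}\frac{q^{n(n-1)/2}(t(1-q))^n}{(q;q)_n}.$$ The $q$-Bernoulli polynomials $B_n(z;q)$ are defined by the generating function (expanded about $t=0$) $$\frac{t\,E_q(zt)}{e_q(\frac t2)E_q(\frac t2)-1}=\sum_{n=0}^\infty B_n(z;q)\frac{t^n}{[n]_q!}.$$ Let $j^{(2)}_{1,1/2}$ be the smallest positive zero of $J^{(2)}_{1/2}(\cdot\,;q^2)$, where $$J^{(2)}_\alpha(x;q)=\frac{(q^{\alpha+1};q)_\infty}{(q;q)_\infty}\sum_{n=0}^\infty(-1)^n\frac{q^{n(\alpha+n)}(\frac x2)^{2n+\alpha}}{(q;q)_n(q^{\alpha+1};q)_n}$$ is the second Jackson $q$-Bessel function. Let $f(z)=\sum_{n=0}^\infty f_nz^n$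 $(z\in\mathbb C)$ be an entire function such that $$\lim_{n\to\infty}\sqrt[n]{\left|\frac{f_n}{\Psi_n}\right|}=\tau,\qquad \Psi_n=\frac{q^{n(n-1)/2}}{[n]_q!},\qquad 0\le\tau<\min\left\{\frac2{1-q},\frac{j^{(2)}_{1,1/2}}{1-q}\right\}.$$ Then, for every $z\in\mathbb C$, $$f(z)=\sum_{n=0}^\infty L_n(f)\,\frac{B_n(z;q)}{[n]_q!},$$ where, for every $n\ge 0$, $$L_n(f)=(1-q)^{-n}\sum_{k=n}^\infty f_k\,\frac{q^{-k(k-1)/2}\,(q;q)_k\,(-q;q)_{k-n}\,(\frac12)^{k-n}}{(q^2;q)_{k-n}},$$ and all these series converge absolutely. -/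

import Mathlib

open Filter Topology

noncomputable section

/-- The finite `q`-shifted factorial `(a;q)_n = ∏_{i<n} (1 - a q^i)`. -/
def qPoch (a q : ℝ) (n : ℕ) : ℝ :=
  ∏ i ∈ Finset.range n, (1 - a * q ^ i)

/-- The infinite `q`-shifted factorial `(a;q)_∞ = ∏_{i≥0} (1 - a q^i)` (for `|q| < 1`). -/
def qPochInf (a q : ℝ) : ℝ :=
  ∏' i : ℕ, (1 - a * q ^ i)

/-- The `q`-natural number `[n]_q = (1 - q^n)/(1 - q)`. -/
def qNat (q : ℝ) (n : ℕ) : ℝ :=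
  (1 - q ^ n) / (1 - q)

/-- The `q`-factorial `[n]_q! = [1]_q [2]_q ⋯ [n]_q`. -/
def qFact (q : ℝ) (n : ℕ) : ℝ :=
  ∏ i ∈ Finset.range n, qNat q (i + 1)

/-- The second Jackson `q`-Bessel function `J_α^{(2)}(x;q)` on the positive half-line:
`(q^{α+1};q)_∞/(q;q)_∞ * ∑_n (-1)^n q^{n(α+n)} (x/2)^{2n+α} / ((q;q)_n (q^{α+1};q)_n)`. -/
def jacksonBesselTwo (α q x : ℝ) : ℝ :=
  qPochInf (q ^ (α + 1)) q / qPochInf q q *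
    ∑' n : ℕ, (-1 : ℝ) ^ n * (q ^ ((n : ℝ) * (α + n)) * (x / 2) ^ (2 * (n : ℝ) + α)) /
      (qPoch q q n * qPoch (q ^ (α + 1)) q n)

/-- `j^{(2)}_{1,α}`: the smallest positive zero of `J_α^{(2)}(·;q²)`. -/
def firstZeroBesselTwo (α q : ℝ) : ℝ :=
  sInf {x : ℝ | 0 < x ∧ jacksonBesselTwo α (q ^ 2) x = 0}

/-- The Taylor series of `e_q(t) = ∑_n (t(1-q))^n/(q;q)_n`. -/
def qExpSmall (q : ℝ) : PowerSeries ℂ :=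
  PowerSeries.mk fun n => (((1 - q) ^ n / qPoch q q n : ℝ) : ℂ)

/-- The Taylor series of `E_q(t) = ∑_n q^{n(n-1)/2} (t(1-q))^n/(q;q)_n`. -/
def qExpBig (q : ℝ) : PowerSeries ℂ :=
  PowerSeries.mk fun n => ((q ^ (n * (n - 1) / 2) * (1 - q) ^ n / qPoch q q n : ℝ) : ℂ)

/-- The Taylor series of `e_q(t/2) E_q(t/2) - 1`. -/
def qBernoulliDenom (q : ℝ) : PowerSeries ℂ :=
  PowerSeries.rescale (1 / 2 : ℂ) (qExpSmall q) * PowerSeries.rescale (1 / 2 : ℂ) (qExpBig q) - 1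

/-- The Taylor series of `(e_q(t/2) E_q(t/2) - 1)/t`. -/
def qBernoulliDenomDivX (q : ℝ) : PowerSeries ℂ :=
  PowerSeries.mk fun n => PowerSeries.coeff (n + 1) (qBernoulliDenom q)

/-- The Taylor series in `t` of `t E_q(zt) / (e_q(t/2) E_q(t/2) - 1)`. -/
def qBernoulliGen (q : ℝ) (z : ℂ) : PowerSeries ℂ :=
  PowerSeries.rescale z (qExpBig q) * (qBernoulliDenomDivX q)⁻¹

/-- The `q`-Bernoulli polynomials `B_n(z;q)`, defined by the generating function
`t E_q(zt) / (e_q(t/2) E_q(t/2) - 1) = ∑_n B_n(z;q) t^n/[n]_q!`. -/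
def qBernoulli (q : ℝ) (n : ℕ) (z : ℂ) : ℂ :=
  (qFact q n : ℂ) * PowerSeries.coeff n (qBernoulliGen q z)

lemma qFact_pos {q : ℝ} (hq0 : 0 < q) (hq1 : q < 1) (n : ℕ) : 0 < qFact q n := by
  refine Finset.prod_pos fun i _ => ?_
  have h : q ^ (i + 1) < 1 := pow_lt_one₀ hq0.le hq1 (Nat.succ_ne_zero i)
  exact div_pos (by linarith) (by linarith)

lemma X_mul_qBernoulliDenomDivX (q : ℝ) :
    PowerSeries.X * qBernoulliDenomDivX q = qBernoulliDenom q := by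
  ext n
  cases n with
  | zero =>
    rw [PowerSeries.coeff_zero_X_mul]
    simp [-PowerSeries.coeff_zero_eq_constantCoeff, qBernoulliDenom, qExpSmall, qExpBig, qPoch,
      PowerSeries.coeff_mul]
  | succ n => simp [PowerSeries.coeff_succ_X_mul, qBernoulliDenomDivX]

lemma constantCoeff_qBernoulliDenomDivX {q : ℝ} (hq1 : q < 1) :
    PowerSeries.constantCoeff (qBernoulliDenomDivX q) = 1 := by
  have h : (1 - (q : ℂ)) ≠ 0 := by
    rw [sub_ne_zero]; exact_mod_cast hq1.ne'
  rw [← PowerSeries.coeff_zero_eq_constantCoeff_apply]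
  simp [qBernoulliDenomDivX, qBernoulliDenom, qExpSmall, qExpBig, qPoch, PowerSeries.coeff_mul,
    Finset.Nat.antidiagonal_succ, PowerSeries.coeff_one]
  field_simp
  norm_num

/-- The defining identity of the `q`-Bernoulli polynomials, cleared of its denominator. -/
lemma qBernoulli_generating {q : ℝ} (hq0 : 0 < q) (hq1 : q < 1) (z : ℂ) :
    (PowerSeries.mk fun n => qBernoulli q n z / (qFact q n : ℂ)) * qBernoulliDenom q =
      PowerSeries.X * PowerSeries.rescale z (qExpBig q) := by
  have h1 : (PowerSeries.mk fun n => qBernoulli q n z / (qFact q n : ℂ)) = qBernoulliGen q z := by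
    ext n
    have h : (qFact q n : ℂ) ≠ 0 := by exact_mod_cast (qFact_pos hq0 hq1 n).ne'
    simp only [PowerSeries.coeff_mk, qBernoulli]
    field_simp
  have h2 : (qBernoulliDenomDivX q)⁻¹ * qBernoulliDenomDivX q = 1 :=
    PowerSeries.inv_mul_cancel _ (by rw [constantCoeff_qBernoulliDenomDivX hq1]; exact one_ne_zero)
  rw [h1, ← X_mul_qBernoulliDenomDivX, qBernoulliGen]
  calc _ = PowerSeries.X * PowerSeries.rescale z (qExpBig q) *
        ((qBernoulliDenomDivX q)⁻¹ * qBernoulliDenomDivX q) := by ring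
    _ = _ := by rw [h2, mul_one]

/-- `Ψ_n = q^{n(n-1)/2}/[n]_q!`. -/
def qPsi (q : ℝ) (n : ℕ) : ℝ :=
  q ^ (n * (n - 1) / 2) / qFact q n

/-- The summand with index `k = n + m` of the series for `L_n(f)`, where `f(z) = ∑_k a_k z^k`:
`a_k q^{-k(k-1)/2} (q;q)_k (-q;q)_{k-n} (1/2)^{k-n} / (q²;q)_{k-n}`. -/
def qBernoulliCoeffTerm (q : ℝ) (a : ℕ → ℂ) (n m : ℕ) : ℂ :=
  a (n + m) * (((q ^ ((n + m) * (n + m - 1) / 2))⁻¹ * qPoch q q (n + m) *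
    qPoch (-q) q m * (1 / 2) ^ m / qPoch (q ^ 2) q m : ℝ) : ℂ)

/-- `L_n(f) = (1-q)^{-n} ∑_{k≥n} a_k q^{-k(k-1)/2} (q;q)_k (-q;q)_{k-n} (1/2)^{k-n} / (q²;q)_{k-n}`
for `f(z) = ∑_k a_k z^k`. -/
def qBernoulliCoeff (q : ℝ) (a : ℕ → ℂ) (n : ℕ) : ℂ :=
  ((((1 - q) ^ n)⁻¹ : ℝ) : ℂ) * ∑' m : ℕ, qBernoulliCoeffTerm q a n m

end

open Filter Topology

noncomputable section

/-! Write `D(t) = (e_q(t/2) E_q(t/2) - 1)/t = ∑ d_m t^m`, `G(t) = E_q(zt)/D(t) = ∑ b_n t^n` with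
`b_n = B_n(z;q)/[n]_q!`, and `u_k = f_k/Ψ_k`. Since `E_q(zt) = ∑ Ψ_k z^k t^k`, the value `f(z)` is
the sum of `u_k` times the `k`-th coefficient of `G·D`. Regrouping by `n` in `k = n + m` gives `∑_n
b_n ∑_m u_{n+m} d_m`, and the closed form of `d_m` (`coeff_qBernoulliDenomDivX`) identifies the
inner sum with `L_n(f)`.

The regrouping is legitimate once `‖u_k‖ ≤ C r^k` for some `r > τ` at which `D` and `G` both
converge absolutely. `D` converges for `‖t‖ < 2/(1-q)`, and `G` as far as `D` has no zero
(`psConv_inv`). A zero of `D` means `e_q(t/2) E_q(t/2) = 1` with `t ≠ 0`; as `e_q(w) E_q(-w) = 1`,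
this says `E_q(t/2) = E_q(-t/2)`. Comparing moduli factor by factor in `E_q(w) = ∏ (1 + (1-q) q^i
w)` forces `t` to be imaginary (`re_eq_zero_of_qExpBig_eq`), and there the odd part of `E_q` is a
multiple of the Bessel series, so `(1-q)‖t‖` is at least its first zero (`firstZeroBesselTwo_le`).
-/

/-! ### Evaluation and inversion of power series -/

/-- The sum of a complex power series at a point. -/
def psEval (A : PowerSeries ℂ) (t : ℂ) : ℂ :=
  ∑' n : ℕ, PowerSeries.coeff n A * t ^ n

/-- Absolute convergence of a complex power series at a point. -/
def PSConv (A : PowerSeries ℂ) (t : ℂ) : Prop :=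
  Summable fun n : ℕ => ‖PowerSeries.coeff n A * t ^ n‖

lemma PSConv.hasSum {A : PowerSeries ℂ} {t : ℂ} (h : PSConv A t) :
    HasSum (fun n : ℕ => PowerSeries.coeff n A * t ^ n) (psEval A t) :=
  (Summable.of_norm h).hasSum

lemma PSConv.mono {A : PowerSeries ℂ} {s t : ℂ} (h : PSConv A t) (hst : ‖s‖ ≤ ‖t‖) :
    PSConv A s := by
  refine Summable.of_nonneg_of_le (fun _ => norm_nonneg _) (fun n => ?_) h
  rw [norm_mul, norm_mul, norm_pow, norm_pow]
  gcongr

lemma coeff_mul_mul_pow (A B : PowerSeries ℂ) (t : ℂ) (n : ℕ) :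
    PowerSeries.coeff n (A * B) * t ^ n = ∑ p ∈ Finset.HasAntidiagonal.antidiagonal n,
      (PowerSeries.coeff p.1 A * t ^ p.1) * (PowerSeries.coeff p.2 B * t ^ p.2) := by
  rw [PowerSeries.coeff_mul, Finset.sum_mul]
  refine Finset.sum_congr rfl fun p hp => ?_
  rw [← Finset.HasAntidiagonal.mem_antidiagonal.1 hp, pow_add]
  ring

lemma PSConv.mul {A B : PowerSeries ℂ} {t : ℂ} (hA : PSConv A t) (hB : PSConv B t) :
    PSConv (A * B) t := by
  simp only [PSConv, coeff_mul_mul_pow]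
  exact summable_norm_sum_mul_antidiagonal_of_summable_norm
    (f := fun n => PowerSeries.coeff n A * t ^ n) (g := fun n => PowerSeries.coeff n B * t ^ n)
    hA hB

lemma psEval_mul {A B : PowerSeries ℂ} {t : ℂ} (hA : PSConv A t) (hB : PSConv B t) :
    psEval (A * B) t = psEval A t * psEval B t := by
  simp only [psEval, coeff_mul_mul_pow]
  exact (tsum_mul_tsum_eq_tsum_sum_antidiagonal_of_summable_norm hA hB).symm

lemma psConv_rescale {A : PowerSeries ℂ} {c t : ℂ} :
    PSConv (PowerSeries.rescale c A) t ↔ PSConv A (c * t) := by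
  simp only [PSConv, PowerSeries.coeff_rescale, mul_pow]
  simp only [mul_assoc, mul_left_comm]

lemma psEval_rescale (A : PowerSeries ℂ) (c t : ℂ) :
    psEval (PowerSeries.rescale c A) t = psEval A (c * t) := by
  simp only [psEval, PowerSeries.coeff_rescale, mul_pow]
  simp only [mul_assoc, mul_left_comm]

lemma psConv_of_coeff_eq_zero {A : PowerSeries ℂ} {N : ℕ}
    (h : ∀ n, N ≤ n → PowerSeries.coeff n A = 0) (t : ℂ) : PSConv A t := by
  refine summable_of_ne_finset_zero (s := Finset.range N) fun n hn => ?_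
  rw [h n (by simpa using hn)]
  simp

lemma psConv_one (t : ℂ) : PSConv 1 t :=
  psConv_of_coeff_eq_zero (N := 1) (fun n hn => by
    rw [PowerSeries.coeff_one, if_neg (by omega)]) t

lemma psEval_one (t : ℂ) : psEval 1 t = 1 := by
  rw [psEval, tsum_eq_single 0]
  · simp
  · intro n hn
    rw [PowerSeries.coeff_one, if_neg hn, zero_mul]

lemma psConv_X (t : ℂ) : PSConv PowerSeries.X t :=
  psConv_of_coeff_eq_zero (N := 2) (fun n hn => by
    rw [PowerSeries.coeff_X, if_neg (by omega)]) t

lemma psEval_X (t : ℂ) : psEval PowerSeries.X t = t := by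
  rw [psEval, tsum_eq_single 1]
  · simp
  · intro n hn
    rw [PowerSeries.coeff_X, if_neg hn, zero_mul]

lemma PSConv.sub {A B : PowerSeries ℂ} {t : ℂ} (hA : PSConv A t) (hB : PSConv B t) :
    PSConv (A - B) t := by
  have := (hA.hasSum.sub hB.hasSum).summable.norm
  simpa only [PSConv, map_sub, sub_mul] using this

lemma psEval_sub {A B : PowerSeries ℂ} {t : ℂ} (hA : PSConv A t) (hB : PSConv B t) :
    psEval (A - B) t = psEval A t - psEval B t := by
  have := (hA.hasSum.sub hB.hasSum).tsum_eq
  simpa only [psEval, map_sub, sub_mul] using this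

lemma PSConv.add {A B : PowerSeries ℂ} {t : ℂ} (hA : PSConv A t) (hB : PSConv B t) :
    PSConv (A + B) t := by
  have := (hA.hasSum.add hB.hasSum).summable.norm
  simpa only [PSConv, map_add, add_mul] using this

lemma psEval_add {A B : PowerSeries ℂ} {t : ℂ} (hA : PSConv A t) (hB : PSConv B t) :
    psEval (A + B) t = psEval A t + psEval B t := by
  have := (hA.hasSum.add hB.hasSum).tsum_eq
  simpa only [psEval, map_add, add_mul] using this

lemma psConv_C (c t : ℂ) : PSConv (PowerSeries.C c) t :=
  psConv_of_coeff_eq_zero (N := 1) (fun n hn => by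
    rw [PowerSeries.coeff_C, if_neg (by omega)]) t

lemma psEval_C (c t : ℂ) : psEval (PowerSeries.C c) t = c := by
  rw [psEval, tsum_eq_single 0]
  · simp
  · intro n hn
    rw [PowerSeries.coeff_C, if_neg hn, zero_mul]

/-- A convergent power series is continuous at `0` along a geometric sequence. -/
lemma tendsto_psEval_geometric {A : PowerSeries ℂ} {t c : ℂ} (h : PSConv A t) (hc : ‖c‖ < 1) :
    Tendsto (fun N : ℕ => psEval A (c ^ N * t)) atTop (𝓝 (PowerSeries.coeff 0 A)) := by
  have h0 : PowerSeries.coeff 0 A = ∑' n : ℕ, PowerSeries.coeff n A * (0 * t) ^ n := by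
    rw [tsum_eq_single 0]
    · simp
    · intro n hn
      simp [hn]
  rw [h0]
  refine tendsto_tsum_of_dominated_convergence h (fun n => ?_) (Eventually.of_forall fun N n => ?_)
  · exact (((tendsto_pow_atTop_nhds_zero_of_norm_lt_one hc).mul_const t).pow n).const_mul _
  · rw [norm_mul, norm_mul, norm_pow, norm_pow, norm_mul, norm_pow]
    have : ‖c‖ ^ N * ‖t‖ ≤ ‖t‖ :=
      mul_le_of_le_one_left (norm_nonneg _) (pow_le_one₀ (norm_nonneg _) hc.le)
    gcongr

/-- A power series that converges to `0` on a disc is `0`. -/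
lemma eq_zero_of_psEval_eq_zero {A : PowerSeries ℂ} {R : ℝ} (hR : 0 < R)
    (hA : ∀ t : ℂ, ‖t‖ < R → PSConv A t) (h : ∀ t : ℂ, ‖t‖ < R → psEval A t = 0) : A = 0 := by
  have hp : HasFPowerSeriesAt (0 : ℂ → ℂ)
      (FormalMultilinearSeries.ofScalars ℂ fun n => PowerSeries.coeff n A) 0 := by
    rw [hasFPowerSeriesAt_iff]
    filter_upwards [Metric.ball_mem_nhds (0 : ℂ) hR] with t ht
    have ht' : ‖t‖ < R := by simpa using ht
    have := (hA t ht').hasSum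
    rw [h t ht'] at this
    simpa [FormalMultilinearSeries.coeff_ofScalars, mul_comm] using this
  have h0 := hp.eq_zero
  ext n
  rw [← FormalMultilinearSeries.coeff_ofScalars (𝕜 := ℂ) (p := fun n => PowerSeries.coeff n A), h0]
  simp [FormalMultilinearSeries.coeff]

lemma differentiableOn_psEval {A : PowerSeries ℂ} {R : ℝ}
    (hA : ∀ t : ℂ, ‖t‖ < R → PSConv A t) : DifferentiableOn ℂ (psEval A) (Metric.ball 0 R) := by
  intro t ht
  have ht' : ‖t‖ < R := by simpa using ht
  obtain ⟨s, hts, hsR⟩ := exists_between ht'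
  have hs0 : 0 ≤ s := (norm_nonneg t).trans hts.le
  have hs : ‖(s : ℂ)‖ = s := by simp [abs_of_nonneg hs0]
  have key : DifferentiableOn ℂ (psEval A) (Metric.ball 0 s) := by
    refine Complex.differentiableOn_tsum_of_summable_norm (hA s (by rwa [hs])) (fun n => ?_)
      Metric.isOpen_ball (fun n w hw => ?_)
    · fun_prop
    · have hw' : ‖w‖ ≤ ‖(s : ℂ)‖ := by
        rw [hs]
        exact le_of_lt (by simpa using hw)
      rw [norm_mul, norm_mul, norm_pow, norm_pow]
      gcongr
  exact ((key t (by simpa using hts)).differentiableAt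
    (Metric.isOpen_ball.mem_nhds (by simpa using hts))).differentiableWithinAt

/-- The inverse of a power series converges on every disc where the sum has no zero. -/
lemma psConv_inv {A : PowerSeries ℂ} {R : ℝ} (hA : ∀ t : ℂ, ‖t‖ < R → PSConv A t)
    (h0 : ∀ t : ℂ, ‖t‖ < R → psEval A t ≠ 0) {t : ℂ} (ht : ‖t‖ < R) : PSConv A⁻¹ t := by
  have hR : 0 < R := (norm_nonneg t).trans_lt ht
  have hg : DifferentiableOn ℂ (fun s => (psEval A s)⁻¹) (Metric.ball 0 R) :=
    (differentiableOn_psEval hA).inv fun s hs => h0 s (by simpa using hs)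
  -- The Taylor series of the holomorphic function `1/A` converges on the whole disc; uniqueness of
  -- coefficients then identifies it with the formal inverse.
  let C : PowerSeries ℂ := PowerSeries.mk fun n =>
    ((n.factorial : ℂ))⁻¹ * iteratedDeriv n (fun s => (psEval A s)⁻¹) 0
  have hC : ∀ s : ℂ, ‖s‖ < R →
      HasSum (fun n : ℕ => PowerSeries.coeff n C * s ^ n) (psEval A s)⁻¹ := by
    intro s hs
    have := Complex.hasSum_taylorSeries_on_ball hg (z := s) (by simpa using hs)
    simp only [sub_zero, smul_eq_mul] at this
    have hterm : (fun n : ℕ => PowerSeries.coeff n C * s ^ n) = fun n : ℕ => (n.factorial : ℂ)⁻¹ *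
        (s ^ n * iteratedDeriv n (fun s => (psEval A s)⁻¹) 0) := by
      funext n
      rw [PowerSeries.coeff_mk]
      ring
    rwa [hterm]
  have hCc : ∀ s : ℂ, ‖s‖ < R → PSConv C s := fun s hs => (hC s hs).summable.norm
  have hprod : C * A - 1 = 0 := by
    refine eq_zero_of_psEval_eq_zero hR
      (fun s hs => ((hCc s hs).mul (hA s hs)).sub (psConv_one s)) fun s hs => ?_
    rw [psEval_sub ((hCc s hs).mul (hA s hs)) (psConv_one s), psEval_mul (hCc s hs) (hA s hs),
      psEval_one, show psEval C s = (psEval A s)⁻¹ from (hC s hs).tsum_eq,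
      inv_mul_cancel₀ (h0 s hs), sub_self]
  have hCA : C * A = 1 := sub_eq_zero.1 hprod
  have hconst : PowerSeries.constantCoeff A ≠ 0 := by
    intro h
    have := congrArg PowerSeries.constantCoeff hCA
    simp [h] at this
  rw [← (PowerSeries.eq_inv_iff_mul_eq_one hconst).2 hCA]
  exact hCc t ht

/-! ### The `q`-exponentials and their `q`-difference equations -/

lemma qPoch_succ (a q : ℝ) (n : ℕ) : qPoch a q (n + 1) = qPoch a q n * (1 - a * q ^ n) :=
  Finset.prod_range_succ _ _

lemma one_sub_pow_succ_pos {q : ℝ} (hq0 : 0 < q) (hq1 : q < 1) (n : ℕ) : 0 < 1 - q ^ (n + 1) :=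
  sub_pos.2 (pow_lt_one₀ hq0.le hq1 n.succ_ne_zero)

lemma qPoch_pos {a q : ℝ} (hq0 : 0 < q) (hq1 : q < 1) (ha : a < 1) (n : ℕ) :
    0 < qPoch a q n := by
  refine Finset.prod_pos fun i _ => sub_pos.2 ?_
  have h1 : 0 < q ^ i := pow_pos hq0 i
  have h2 : q ^ i ≤ 1 := pow_le_one₀ hq0.le hq1.le
  nlinarith

lemma qFact_eq {q : ℝ} (hq1 : q < 1) (n : ℕ) : qFact q n = qPoch q q n / (1 - q) ^ n := by
  have : 1 - q ≠ 0 := (sub_pos.2 hq1).ne'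
  simp only [qFact, qNat, qPoch, Finset.prod_div_distrib, Finset.prod_const, Finset.card_range,
    pow_succ']

lemma triangle_succ (n : ℕ) : (n + 1) * (n + 1 - 1) / 2 = n * (n - 1) / 2 + n := by
  rw [← Finset.sum_range_id, ← Finset.sum_range_id, Finset.sum_range_succ]

lemma qPoch_ne_zero {a q : ℝ} (hq0 : 0 < q) (hq1 : q < 1) (ha : a < 1) (n : ℕ) :
    (qPoch a q n : ℂ) ≠ 0 := by exact_mod_cast (qPoch_pos hq0 hq1 ha n).ne'

lemma coeff_qExpSmall_succ {q : ℝ} (hq0 : 0 < q) (hq1 : q < 1) (n : ℕ) :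
    PowerSeries.coeff (n + 1) (qExpSmall q) * (1 - (q : ℂ) ^ (n + 1)) =
      (1 - q) * PowerSeries.coeff n (qExpSmall q) := by
  have h1 := (one_sub_pow_succ_pos hq0 hq1 n).ne'
  have h2 := (qPoch_pos hq0 hq1 hq1 n).ne'
  have : (1 - q) ^ (n + 1) / qPoch q q (n + 1) * (1 - q ^ (n + 1)) =
      (1 - q) * ((1 - q) ^ n / qPoch q q n) := by
    rw [qPoch_succ, ← pow_succ' q]
    field_simp
    ring
  simp only [qExpSmall, PowerSeries.coeff_mk]
  exact_mod_cast this

lemma coeff_qExpBig_succ {q : ℝ} (hq0 : 0 < q) (hq1 : q < 1) (n : ℕ) :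
    PowerSeries.coeff (n + 1) (qExpBig q) * (1 - (q : ℂ) ^ (n + 1)) =
      (1 - q) * (q : ℂ) ^ n * PowerSeries.coeff n (qExpBig q) := by
  have h1 := (one_sub_pow_succ_pos hq0 hq1 n).ne'
  have h2 := (qPoch_pos hq0 hq1 hq1 n).ne'
  have : q ^ ((n + 1) * (n + 1 - 1) / 2) * (1 - q) ^ (n + 1) / qPoch q q (n + 1) *
      (1 - q ^ (n + 1)) =
      (1 - q) * q ^ n * (q ^ (n * (n - 1) / 2) * (1 - q) ^ n / qPoch q q n) := by
    rw [qPoch_succ, ← pow_succ' q, triangle_succ, pow_add]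
    field_simp
    ring
  simp only [qExpBig, PowerSeries.coeff_mk]
  exact_mod_cast this

lemma coeff_zero_qExpSmall (q : ℝ) : PowerSeries.coeff 0 (qExpSmall q) = 1 := by
  rw [qExpSmall, PowerSeries.coeff_mk]
  simp [qPoch]

lemma coeff_zero_qExpBig (q : ℝ) : PowerSeries.coeff 0 (qExpBig q) = 1 := by
  rw [qExpBig, PowerSeries.coeff_mk]
  simp [qPoch]

/-- This and `qExpBig_eq` encode the recurrences of the coefficients; iterating them under `t ↦ qt`
replaces the infinite product formulas. -/
lemma one_sub_X_mul_qExpSmall {q : ℝ} (hq0 : 0 < q) (hq1 : q < 1) :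
    (1 - PowerSeries.C (1 - (q : ℂ)) * PowerSeries.X) * qExpSmall q =
      PowerSeries.rescale (q : ℂ) (qExpSmall q) := by
  ext n
  rw [sub_mul, one_mul, mul_assoc, map_sub, PowerSeries.coeff_C_mul, PowerSeries.coeff_rescale]
  cases n with
  | zero => rw [PowerSeries.coeff_zero_X_mul]; simp
  | succ n =>
    rw [PowerSeries.coeff_succ_X_mul]
    linear_combination coeff_qExpSmall_succ hq0 hq1 n

lemma qExpBig_eq {q : ℝ} (hq0 : 0 < q) (hq1 : q < 1) :
    qExpBig q = (1 + PowerSeries.C (1 - (q : ℂ)) * PowerSeries.X) *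
      PowerSeries.rescale (q : ℂ) (qExpBig q) := by
  ext n
  rw [add_mul, one_mul, mul_assoc, map_add, PowerSeries.coeff_C_mul, PowerSeries.coeff_rescale]
  cases n with
  | zero => rw [PowerSeries.coeff_zero_X_mul]; simp
  | succ n =>
    rw [PowerSeries.coeff_succ_X_mul, PowerSeries.coeff_rescale]
    linear_combination coeff_qExpBig_succ hq0 hq1 n

/-- Ratio test for a power series with a two-term recurrence for its coefficients. -/
lemma psConv_of_ratio {A : PowerSeries ℂ} {r : ℕ → ℂ} {l t : ℂ}
    (h : ∀ n, PowerSeries.coeff (n + 1) A = r n * PowerSeries.coeff n A)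
    (hr : Tendsto r atTop (𝓝 l)) (ht : ‖l‖ * ‖t‖ < 1) : PSConv A t := by
  obtain ⟨s, hs, hs1⟩ := exists_between ht
  have hev : ∀ᶠ n in atTop, ‖r n‖ * ‖t‖ < s := (hr.norm.mul_const ‖t‖).eventually_lt_const hs
  refine summable_of_ratio_norm_eventually_le hs1 ?_
  filter_upwards [hev] with n hn
  rw [h, pow_succ]
  simp only [norm_mul, norm_norm]
  calc _ = (‖r n‖ * ‖t‖) * (‖PowerSeries.coeff n A‖ * ‖t ^ n‖) := by ring
    _ ≤ _ := by gcongr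

lemma tendsto_ofReal_pow {q : ℝ} (hq0 : 0 < q) (hq1 : q < 1) :
    Tendsto (fun n : ℕ => (q : ℂ) ^ n) atTop (𝓝 0) :=
  tendsto_pow_atTop_nhds_zero_of_norm_lt_one (by simpa [abs_of_pos hq0] using hq1)

lemma one_sub_ofReal_pow_ne_zero {q : ℝ} (hq0 : 0 < q) (hq1 : q < 1) (n : ℕ) :
    1 - (q : ℂ) ^ (n + 1) ≠ 0 := by
  exact_mod_cast (one_sub_pow_succ_pos hq0 hq1 n).ne'

lemma psConv_qExpSmall {q : ℝ} (hq0 : 0 < q) (hq1 : q < 1) {t : ℂ} (ht : (1 - q) * ‖t‖ < 1) :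
    PSConv (qExpSmall q) t := by
  refine psConv_of_ratio (r := fun n => (1 - q) / (1 - (q : ℂ) ^ (n + 1))) (l := 1 - q)
    (fun n => ?_) ?_ ?_
  · rw [div_mul_eq_mul_div, eq_div_iff (one_sub_ofReal_pow_ne_zero hq0 hq1 n)]
    exact coeff_qExpSmall_succ hq0 hq1 n
  · have := ((tendsto_ofReal_pow hq0 hq1).comp (tendsto_add_atTop_nat 1)).const_sub 1
    simpa [Pi.div_def] using (tendsto_const_nhds (x := (1 - q : ℂ))).div this (by simp)
  · have : ‖(1 - q : ℂ)‖ = 1 - q := by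
      rw [← Complex.ofReal_one, ← Complex.ofReal_sub, Complex.norm_real, Real.norm_eq_abs,
        abs_of_pos (sub_pos.2 hq1)]
    rwa [this]

lemma psConv_qExpBig {q : ℝ} (hq0 : 0 < q) (hq1 : q < 1) (t : ℂ) : PSConv (qExpBig q) t := by
  refine psConv_of_ratio (r := fun n => (1 - q) * (q : ℂ) ^ n / (1 - (q : ℂ) ^ (n + 1))) (l := 0)
    (fun n => ?_) ?_ (by simp)
  · rw [div_mul_eq_mul_div, eq_div_iff (one_sub_ofReal_pow_ne_zero hq0 hq1 n)]
    exact coeff_qExpBig_succ hq0 hq1 n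
  · have := ((tendsto_ofReal_pow hq0 hq1).comp (tendsto_add_atTop_nat 1)).const_sub 1
    simpa [Pi.div_def] using ((tendsto_ofReal_pow hq0 hq1).const_mul (1 - q : ℂ)).div this (by simp)

lemma psEval_qExpSmall_mul {q : ℝ} (hq0 : 0 < q) (hq1 : q < 1) (t : ℂ)
    (ht : (1 - q) * ‖t‖ < 1) :
    (1 - (1 - q) * t) * psEval (qExpSmall q) t = psEval (qExpSmall q) (q * t) := by
  have hc := psConv_qExpSmall hq0 hq1 ht
  rw [← psEval_rescale, ← one_sub_X_mul_qExpSmall hq0 hq1,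
    psEval_mul ((psConv_one t).sub ((psConv_C _ t).mul (psConv_X t))) hc,
    psEval_sub (psConv_one t) ((psConv_C _ t).mul (psConv_X t)),
    psEval_mul (psConv_C _ t) (psConv_X t), psEval_one, psEval_C, psEval_X]

lemma psEval_qExpBig_eq {q : ℝ} (hq0 : 0 < q) (hq1 : q < 1) (t : ℂ) :
    psEval (qExpBig q) t = (1 + (1 - q) * t) * psEval (qExpBig q) (q * t) := by
  rw [← psEval_rescale]
  conv_lhs => rw [qExpBig_eq hq0 hq1]
  rw [psEval_mul ((psConv_one t).add ((psConv_C _ t).mul (psConv_X t)))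
      (psConv_rescale.2 (psConv_qExpBig hq0 hq1 _)),
    psEval_add (psConv_one t) ((psConv_C _ t).mul (psConv_X t)),
    psEval_mul (psConv_C _ t) (psConv_X t), psEval_one, psEval_C, psEval_X]

lemma norm_ofReal_pow_mul_le {q : ℝ} (hq0 : 0 < q) (hq1 : q < 1) (N : ℕ) (t : ℂ) :
    ‖(q : ℂ) ^ N * t‖ ≤ ‖t‖ := by
  rw [norm_mul, norm_pow, Complex.norm_real, Real.norm_eq_abs, abs_of_pos hq0]
  exact mul_le_of_le_one_left (norm_nonneg _) (pow_le_one₀ hq0.le hq1.le)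

/-- The identity `e_q(t) E_q(-t) = 1`. -/
lemma psEval_qExpSmall_mul_qExpBig_neg {q : ℝ} (hq0 : 0 < q) (hq1 : q < 1) {t : ℂ}
    (ht : (1 - q) * ‖t‖ < 1) :
    psEval (qExpSmall q) t * psEval (qExpBig q) (-t) = 1 := by
  have hq : ‖(q : ℂ)‖ < 1 := by simpa [abs_of_pos hq0] using hq1
  -- The product is invariant under `t ↦ qt`, hence equal to its limit `1` at `0`.
  have hstep : ∀ N : ℕ, psEval (qExpSmall q) ((q : ℂ) ^ N * t) *
      psEval (qExpBig q) ((q : ℂ) ^ N * -t) =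
      psEval (qExpSmall q) t * psEval (qExpBig q) (-t) := by
    intro N
    induction N with
    | zero => simp
    | succ N ih =>
      have hN : (1 - q) * ‖(q : ℂ) ^ N * t‖ < 1 :=
        (mul_le_mul_of_nonneg_left (norm_ofReal_pow_mul_le hq0 hq1 N t)
          (sub_pos.2 hq1).le).trans_lt ht
      rw [← ih, psEval_qExpBig_eq hq0 hq1 ((q : ℂ) ^ N * -t), pow_succ', mul_assoc, mul_assoc,
        ← psEval_qExpSmall_mul hq0 hq1 _ hN]
      ring
  have hlim := (tendsto_psEval_geometric (psConv_qExpSmall hq0 hq1 ht) hq).mul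
    (tendsto_psEval_geometric (psConv_qExpBig hq0 hq1 (-t)) hq)
  rw [coeff_zero_qExpSmall, coeff_zero_qExpBig, mul_one] at hlim
  simp only [hstep] at hlim
  exact tendsto_nhds_unique tendsto_const_nhds hlim

/-! ### Solutions of `E_q(t) = E_q(-t)` -/

lemma norm_one_sub_lt_norm_one_add {w : ℂ} (hw : 0 < w.re) : ‖1 - w‖ < ‖1 + w‖ := by
  rw [← sq_lt_sq₀ (norm_nonneg _) (norm_nonneg _), ← Complex.normSq_eq_norm_sq,
    ← Complex.normSq_eq_norm_sq, Complex.normSq_apply, Complex.normSq_apply]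
  simp only [Complex.sub_re, Complex.sub_im, Complex.add_re, Complex.add_im, Complex.one_re,
    Complex.one_im]
  nlinarith

/-- Each factor satisfies `|1 - (1-q)q^i t| < |1 + (1-q)q^i t|`. The induction peels off `N` factors
in cross-multiplied form, so no division by a possibly vanishing value occurs; the limit keeps only
a weak inequality. -/
lemma norm_qExpBig_neg_le {q : ℝ} (hq0 : 0 < q) (hq1 : q < 1) {t : ℂ} (ht : 0 < t.re) :
    ‖psEval (qExpBig q) (-t)‖ ≤ ‖psEval (qExpBig q) t‖ := by
  have hq : ‖(q : ℂ)‖ < 1 := by simpa [abs_of_pos hq0] using hq1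
  have hstep : ∀ N : ℕ, ‖psEval (qExpBig q) (-t)‖ * ‖psEval (qExpBig q) ((q : ℂ) ^ N * t)‖ ≤
      ‖psEval (qExpBig q) t‖ * ‖psEval (qExpBig q) ((q : ℂ) ^ N * -t)‖ := by
    intro N
    induction N with
    | zero => simp [mul_comm]
    | succ N ih =>
      rw [psEval_qExpBig_eq hq0 hq1 ((q : ℂ) ^ N * t),
        psEval_qExpBig_eq hq0 hq1 ((q : ℂ) ^ N * -t), ← mul_assoc (q : ℂ) _ t,
        ← mul_assoc (q : ℂ) _ (-t), ← pow_succ', norm_mul, norm_mul] at ih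
      have hre : 0 < ((1 - q : ℂ) * ((q : ℂ) ^ N * t)).re := by
        have : (1 - q : ℂ) * ((q : ℂ) ^ N * t) = (((1 - q) * q ^ N : ℝ) : ℂ) * t := by
          push_cast; ring
        rw [this, Complex.re_ofReal_mul]
        exact mul_pos (mul_pos (sub_pos.2 hq1) (pow_pos hq0 N)) ht
      have hlt := norm_one_sub_lt_norm_one_add hre
      have heq : 1 + (1 - q : ℂ) * ((q : ℂ) ^ N * -t) = 1 - (1 - q : ℂ) * ((q : ℂ) ^ N * t) := by
        ring
      rw [heq] at ih
      set x := ‖1 + (1 - q : ℂ) * ((q : ℂ) ^ N * t)‖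
      set y := ‖1 - (1 - q : ℂ) * ((q : ℂ) ^ N * t)‖
      have hx : 0 < x := (norm_nonneg _).trans_lt hlt
      refine le_of_mul_le_mul_left ?_ hx
      calc _ = _ := mul_left_comm _ _ _
        _ ≤ _ := ih
        _ = y * (‖psEval (qExpBig q) t‖ * ‖psEval (qExpBig q) ((q : ℂ) ^ (N + 1) * -t)‖) :=
          mul_left_comm _ _ _
        _ ≤ _ := mul_le_mul_of_nonneg_right hlt.le (by positivity)
  have h1 := ((tendsto_psEval_geometric (psConv_qExpBig hq0 hq1 t) hq).norm).const_mul
    ‖psEval (qExpBig q) (-t)‖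
  have h2 := ((tendsto_psEval_geometric (psConv_qExpBig hq0 hq1 (-t)) hq).norm).const_mul
    ‖psEval (qExpBig q) t‖
  rw [coeff_zero_qExpBig, norm_one, mul_one] at h1 h2
  exact le_of_tendsto_of_tendsto' h1 h2 hstep

/-- Strictness comes from the first factor alone. It survives multiplication because `E_q(qt) ≠ 0`,
which the bound on `‖t‖` yields through `e_q(-qt) E_q(qt) = 1`. -/
lemma norm_qExpBig_neg_lt {q : ℝ} (hq0 : 0 < q) (hq1 : q < 1) {t : ℂ} (ht : 0 < t.re)
    (ht1 : (1 - q) * ‖t‖ < 1) :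
    ‖psEval (qExpBig q) (-t)‖ < ‖psEval (qExpBig q) t‖ := by
  have hqt : 0 < ((q : ℂ) * t).re := by
    rw [Complex.re_ofReal_mul]
    exact mul_pos hq0 ht
  have hle := norm_qExpBig_neg_le hq0 hq1 hqt
  have hn : (1 - q) * ‖-((q : ℂ) * t)‖ < 1 := by
    have := norm_ofReal_pow_mul_le hq0 hq1 1 t
    rw [pow_one] at this
    rw [norm_neg]
    exact (mul_le_mul_of_nonneg_left this (sub_pos.2 hq1).le).trans_lt ht1
  have hne : psEval (qExpBig q) (q * t) ≠ 0 := by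
    have := psEval_qExpSmall_mul_qExpBig_neg hq0 hq1 hn
    rw [neg_neg] at this
    exact right_ne_zero_of_mul_eq_one this
  have hre : 0 < ((1 - q : ℂ) * t).re := by
    rw [← Complex.ofReal_one, ← Complex.ofReal_sub, Complex.re_ofReal_mul]
    exact mul_pos (sub_pos.2 hq1) ht
  have hlt := norm_one_sub_lt_norm_one_add hre
  rw [psEval_qExpBig_eq hq0 hq1 t, psEval_qExpBig_eq hq0 hq1 (-t), norm_mul, norm_mul,
    mul_neg, mul_neg, ← sub_eq_add_neg]
  calc _ ≤ ‖1 - (1 - q : ℂ) * t‖ * ‖psEval (qExpBig q) (q * t)‖ := by gcongr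
    _ < _ := mul_lt_mul_of_pos_right hlt (norm_pos_iff.2 hne)

/-- The solutions of `E_q(t) = E_q(-t)` near `0` are purely imaginary. -/
lemma re_eq_zero_of_qExpBig_eq {q : ℝ} (hq0 : 0 < q) (hq1 : q < 1) {t : ℂ}
    (ht1 : (1 - q) * ‖t‖ < 1) (h : psEval (qExpBig q) t = psEval (qExpBig q) (-t)) :
    t.re = 0 := by
  rcases lt_trichotomy t.re 0 with ht | ht | ht
  · have := norm_qExpBig_neg_lt hq0 hq1 (t := -t) (by simpa using ht) (by simpa using ht1)
    rw [neg_neg, h] at this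
    exact (lt_irrefl _ this).elim
  · exact ht
  · have := norm_qExpBig_neg_lt hq0 hq1 ht ht1
    rw [h] at this
    exact (lt_irrefl _ this).elim

/-! ### Link with the second Jackson `q`-Bessel function -/

lemma qPoch_odd (q : ℝ) (k : ℕ) :
    qPoch q q (2 * k + 1) = (1 - q) * (qPoch (q ^ 2) (q ^ 2) k * qPoch (q ^ 3) (q ^ 2) k) := by
  induction k with
  | zero => simp [qPoch]
  | succ k ih =>
    rw [show 2 * (k + 1) + 1 = 2 * k + 1 + 1 + 1 by ring, qPoch_succ, qPoch_succ, ih, qPoch_succ,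
      qPoch_succ]
    ring

/-- In `E_q(w) - E_q(-w)` the even terms cancel, and the odd ones are the Bessel terms times the
nonzero constant `2i (y/2)^{1/2}/(1-q)`. -/
lemma jacksonBesselTwo_half_eq_zero {q : ℝ} (hq0 : 0 < q) (hq1 : q < 1) {y : ℝ} (hy : 0 < y)
    {w : ℂ} (hw : w = Complex.I * ((y / (2 * (1 - q)) : ℝ) : ℂ))
    (h : psEval (qExpBig q) w = psEval (qExpBig q) (-w)) :
    jacksonBesselTwo (1 / 2) (q ^ 2) y = 0 := by
  have hc : 1 - q ≠ 0 := (sub_pos.2 hq1).ne'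
  have hs := (psConv_qExpBig hq0 hq1 w).hasSum.sub (psConv_qExpBig hq0 hq1 (-w)).hasSum
  rw [h, sub_self] at hs
  have hinj : Function.Injective fun k : ℕ => 2 * k + 1 := fun a b hab => by
    simp only at hab; omega
  rw [← hinj.hasSum_iff] at hs
  · have hpow : (q ^ 2) ^ ((1 / 2 : ℝ) + 1) = q ^ 3 := by
      rw [← Real.rpow_natCast q 2, ← Real.rpow_mul hq0.le, ← Real.rpow_natCast q 3]
      norm_num
    have hterm : ∀ k : ℕ, PowerSeries.coeff (2 * k + 1) (qExpBig q) * w ^ (2 * k + 1) -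
        PowerSeries.coeff (2 * k + 1) (qExpBig q) * (-w) ^ (2 * k + 1) =
        2 * Complex.I * (((y / 2) ^ (1 / 2 : ℝ) / (1 - q) : ℝ) : ℂ) *
        (((-1 : ℝ) ^ k * ((q ^ 2) ^ ((k : ℝ) * (1 / 2 + k)) *
          (y / 2) ^ (2 * (k : ℝ) + 1 / 2)) /
          (qPoch (q ^ 2) (q ^ 2) k * qPoch ((q ^ 2) ^ ((1 / 2 : ℝ) + 1)) (q ^ 2) k) : ℝ) : ℂ) := by
      intro k
      have hI : w ^ (2 * k + 1) =
          Complex.I * (((-1) ^ k * (y / (2 * (1 - q))) ^ (2 * k + 1) : ℝ) : ℂ) := by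
        rw [hw, mul_pow, pow_succ Complex.I, pow_mul, Complex.I_sq]
        push_cast
        ring
      have hneg : (-w) ^ (2 * k + 1) = -w ^ (2 * k + 1) := Odd.neg_pow ⟨k, rfl⟩ w
      have hq2 : (q ^ 2) ^ ((k : ℝ) * (1 / 2 + k)) = q ^ ((2 * k + 1) * (2 * k + 1 - 1) / 2) := by
        have he : (2 * k + 1) * (2 * k + 1 - 1) / 2 = (2 * k + 1) * k := by
          rw [Nat.add_sub_cancel, show (2 * k + 1) * (2 * k) = (2 * k + 1) * k * 2 by ring,
            Nat.mul_div_cancel _ two_pos]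
        rw [he, ← Real.rpow_natCast q 2, ← Real.rpow_mul hq0.le, ← Real.rpow_natCast q]
        congr 1
        push_cast
        ring
      have hy2 : (y / 2) ^ (1 / 2 : ℝ) * (y / 2) ^ (2 * (k : ℝ) + 1 / 2) =
          (y / 2) ^ (2 * k + 1) := by
        rw [← Real.rpow_add (by positivity), ← Real.rpow_natCast]
        congr 1
        push_cast
        ring
      have hreal : q ^ ((2 * k + 1) * (2 * k + 1 - 1) / 2) * (1 - q) ^ (2 * k + 1) /
          qPoch q q (2 * k + 1) * ((-1) ^ k * (y / (2 * (1 - q))) ^ (2 * k + 1)) =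
          ((y / 2) ^ (1 / 2 : ℝ) / (1 - q)) * ((-1 : ℝ) ^ k * ((q ^ 2) ^ ((k : ℝ) * (1 / 2 + k)) *
          (y / 2) ^ (2 * (k : ℝ) + 1 / 2)) /
          (qPoch (q ^ 2) (q ^ 2) k * qPoch ((q ^ 2) ^ ((1 / 2 : ℝ) + 1)) (q ^ 2) k)) := by
        rw [hq2, hpow, qPoch_odd]
        have hyq : (y / (2 * (1 - q))) ^ (2 * k + 1) =
            (y / 2) ^ (1 / 2 : ℝ) * (y / 2) ^ (2 * (k : ℝ) + 1 / 2) / (1 - q) ^ (2 * k + 1) := by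
          rw [hy2, ← div_div, div_pow (y / 2)]
        rw [hyq]
        field_simp
      rw [hneg, hI, qExpBig, PowerSeries.coeff_mk, mul_assoc (2 * Complex.I), ← Complex.ofReal_mul,
        ← hreal]
      push_cast
      ring
    have hsum := hs.tsum_eq
    simp only [Function.comp_def, hterm] at hsum
    rw [tsum_mul_left, ← Complex.ofReal_tsum] at hsum
    have hne : 2 * Complex.I * (((y / 2) ^ (1 / 2 : ℝ) / (1 - q) : ℝ) : ℂ) ≠ 0 := by
      have : (y / 2) ^ (1 / 2 : ℝ) / (1 - q) ≠ 0 :=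
        div_ne_zero (Real.rpow_pos_of_pos (by positivity) _).ne' hc
      exact mul_ne_zero (by simp) (by exact_mod_cast this)
    have h0 := (mul_eq_zero.1 hsum).resolve_left hne
    rw [jacksonBesselTwo, Complex.ofReal_eq_zero.1 h0, mul_zero]
  · intro n hn
    have hev : Even n := by
      by_contra ho
      obtain ⟨k, hk⟩ := Nat.not_even_iff_odd.1 ho
      exact hn ⟨k, hk.symm⟩
    rw [hev.neg_pow, sub_self]

lemma firstZeroBesselTwo_le {q : ℝ} (hq0 : 0 < q) (hq1 : q < 1) {t : ℂ} (ht0 : t ≠ 0)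
    (ht : (1 - q) * ‖t / 2‖ < 1)
    (h : psEval (qExpSmall q) (t / 2) * psEval (qExpBig q) (t / 2) = 1) :
    firstZeroBesselTwo (1 / 2) q ≤ (1 - q) * ‖t‖ := by
  have hc : 0 < 1 - q := sub_pos.2 hq1
  have heq : psEval (qExpBig q) (t / 2) = psEval (qExpBig q) (-(t / 2)) := by
    have h1 := psEval_qExpSmall_mul_qExpBig_neg hq0 hq1 ht
    exact mul_left_cancel₀ (left_ne_zero_of_mul_eq_one h1) (h.trans h1.symm)
  have hre := re_eq_zero_of_qExpBig_eq hq0 hq1 ht heq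
  have hy : 0 < (1 - q) * ‖t‖ := mul_pos hc (norm_pos_iff.2 ht0)
  have hquot : (1 - q) * ‖t‖ / (2 * (1 - q)) = ‖t / 2‖ := by
    rw [norm_div, Complex.norm_ofNat]
    field_simp
  have hform : t / 2 = Complex.I * ((t / 2).im : ℂ) := by
    conv_lhs => rw [← Complex.re_add_im (t / 2), hre]
    simp [mul_comm]
  have hnorm : ‖t / 2‖ = |(t / 2).im| := by
    conv_lhs => rw [hform]
    rw [norm_mul, Complex.norm_I, one_mul, Complex.norm_real, Real.norm_eq_abs]
  have hzero : jacksonBesselTwo (1 / 2) (q ^ 2) ((1 - q) * ‖t‖) = 0 := by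
    -- The Bessel argument must be positive; the symmetry `w ↦ -w` of the equation covers the lower
    -- half-axis.
    rcases le_total 0 (t / 2).im with him | him
    · refine jacksonBesselTwo_half_eq_zero hq0 hq1 hy (w := t / 2) ?_ heq
      rw [hquot, hnorm, abs_of_nonneg him]
      exact hform
    · refine jacksonBesselTwo_half_eq_zero hq0 hq1 hy (w := -(t / 2)) ?_ (by rw [neg_neg, heq])
      rw [hquot, hnorm, abs_of_nonpos him, Complex.ofReal_neg, mul_neg, ← hform]
  exact csInf_le ⟨0, fun x hx => hx.1.le⟩ ⟨hy, hzero⟩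

/-! ### Coefficients, convergence and zeros of the denominator -/

/-- `F = e_q E_q` satisfies `(1 - (1-q)t) F(t) = (1 + (1-q)t) F(qt)`; compare coefficients. -/
lemma coeff_qExpSmall_mul_qExpBig_succ {q : ℝ} (hq0 : 0 < q) (hq1 : q < 1) (n : ℕ) :
    PowerSeries.coeff (n + 1) (qExpSmall q * qExpBig q) * (1 - (q : ℂ) ^ (n + 1)) =
      (1 - q) * (1 + (q : ℂ) ^ n) * PowerSeries.coeff n (qExpSmall q * qExpBig q) := by
  have h : (1 - PowerSeries.C (1 - (q : ℂ)) * PowerSeries.X) * (qExpSmall q * qExpBig q) =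
      (1 + PowerSeries.C (1 - (q : ℂ)) * PowerSeries.X) *
        PowerSeries.rescale (q : ℂ) (qExpSmall q * qExpBig q) := by
    rw [← mul_assoc, one_sub_X_mul_qExpSmall hq0 hq1, map_mul]
    conv_lhs => rw [qExpBig_eq hq0 hq1]
    ring
  have hn := congrArg (PowerSeries.coeff (n + 1)) h
  rw [sub_mul, add_mul, one_mul, one_mul, mul_assoc, mul_assoc, map_sub, map_add,
    PowerSeries.coeff_C_mul, PowerSeries.coeff_C_mul, PowerSeries.coeff_succ_X_mul,
    PowerSeries.coeff_succ_X_mul, PowerSeries.coeff_rescale, PowerSeries.coeff_rescale] at hn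
  linear_combination hn

lemma coeff_qBernoulliDenomDivX {q : ℝ} (hq0 : 0 < q) (hq1 : q < 1) (m : ℕ) :
    PowerSeries.coeff m (qBernoulliDenomDivX q) =
    ((qPoch (-q) q m / qPoch (q ^ 2) q m * ((1 - q) / 2) ^ m : ℝ) : ℂ) := by
  have hcoeff : ∀ m : ℕ, PowerSeries.coeff m (qBernoulliDenomDivX q) =
      (1 / 2 : ℂ) ^ (m + 1) * PowerSeries.coeff (m + 1) (qExpSmall q * qExpBig q) := by
    intro m
    rw [qBernoulliDenomDivX, PowerSeries.coeff_mk, qBernoulliDenom, ← map_mul, map_sub,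
      PowerSeries.coeff_rescale, PowerSeries.coeff_one, if_neg m.succ_ne_zero, sub_zero]
  induction m with
  | zero =>
    rw [PowerSeries.coeff_zero_eq_constantCoeff_apply, constantCoeff_qBernoulliDenomDivX hq1]
    simp [qPoch]
  | succ m ih =>
    have hq2 : q ^ 2 < 1 := pow_lt_one₀ hq0.le hq1 two_ne_zero
    have h1 := one_sub_ofReal_pow_ne_zero hq0 hq1 (m + 1)
    have h2 := coeff_qExpSmall_mul_qExpBig_succ hq0 hq1 (m + 1)
    have h3 := qPoch_ne_zero hq0 hq1 hq2 m
    have h4 : (1 - (q : ℂ) ^ 2 * (q : ℂ) ^ m) ≠ 0 := by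
      rw [← pow_add, add_comm]
      exact h1
    rw [hcoeff] at ih
    rw [hcoeff]
    refine mul_right_cancel₀ h1 ?_
    rw [mul_assoc, h2, qPoch_succ, qPoch_succ]
    calc _ = (1 / 2) * ((1 - q) * (1 + (q : ℂ) ^ (m + 1))) *
          ((1 / 2 : ℂ) ^ (m + 1) * PowerSeries.coeff (m + 1) (qExpSmall q * qExpBig q)) := by ring
      _ = _ := by
        rw [ih]
        push_cast
        field_simp
        ring

lemma psConv_qBernoulliDenom {q : ℝ} (hq0 : 0 < q) (hq1 : q < 1) {t : ℂ}
    (ht : (1 - q) * ‖t / 2‖ < 1) :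
    PSConv (qBernoulliDenom q) t ∧
      psEval (qBernoulliDenom q) t =
        psEval (qExpSmall q) (t / 2) * psEval (qExpBig q) (t / 2) - 1 := by
  have ht2 : (1 / 2 : ℂ) * t = t / 2 := by ring
  have h1 : PSConv (PowerSeries.rescale (1 / 2 : ℂ) (qExpSmall q)) t :=
    psConv_rescale.2 (ht2 ▸ psConv_qExpSmall hq0 hq1 ht)
  have h2 : PSConv (PowerSeries.rescale (1 / 2 : ℂ) (qExpBig q)) t :=
    psConv_rescale.2 (psConv_qExpBig hq0 hq1 _)
  refine ⟨(h1.mul h2).sub (psConv_one t), ?_⟩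
  rw [qBernoulliDenom, psEval_sub (h1.mul h2) (psConv_one t), psEval_mul h1 h2, psEval_rescale,
    psEval_rescale, psEval_one, ht2]

lemma psConv_qBernoulliDenomDivX {q : ℝ} (hq0 : 0 < q) (hq1 : q < 1) {t : ℂ}
    (ht : ‖t‖ < 2 / (1 - q)) : PSConv (qBernoulliDenomDivX q) t := by
  have hc : 0 < 1 - q := sub_pos.2 hq1
  -- Moving to a radius `s > 0` allows the division by `s` even when `t = 0`.
  obtain ⟨s, hs, hs1⟩ := exists_between ht
  have hs0 : 0 < s := (norm_nonneg t).trans_lt hs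
  have hsn : ‖(s : ℂ)‖ = s := by simp [abs_of_pos hs0]
  have hs2 : (1 - q) * ‖(s : ℂ) / 2‖ < 1 := by
    rw [norm_div, hsn, Complex.norm_ofNat]
    rw [lt_div_iff₀ hc] at hs1
    linarith
  have h := (psConv_qBernoulliDenom hq0 hq1 hs2).1
  refine PSConv.mono (t := (s : ℂ)) ?_ (by rw [hsn]; exact hs.le)
  have h' := ((summable_nat_add_iff 1).2 h).mul_right s⁻¹
  refine h'.congr fun n => ?_
  rw [qBernoulliDenomDivX, PowerSeries.coeff_mk, norm_mul, norm_mul, norm_pow, norm_pow, hsn,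
    pow_succ]
  field_simp

lemma psEval_qBernoulliDenomDivX_ne_zero {q : ℝ} (hq0 : 0 < q) (hq1 : q < 1) {t : ℂ}
    (ht : ‖t‖ < min (2 / (1 - q)) (firstZeroBesselTwo (1 / 2) q / (1 - q))) :
    psEval (qBernoulliDenomDivX q) t ≠ 0 := by
  have hc : 0 < 1 - q := sub_pos.2 hq1
  obtain ⟨h1, h2⟩ := lt_min_iff.1 ht
  rcases eq_or_ne t 0 with rfl | ht0
  · rw [psEval, tsum_eq_single 0 fun n hn => by simp [hn],
      PowerSeries.coeff_zero_eq_constantCoeff_apply, constantCoeff_qBernoulliDenomDivX hq1]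
    simp
  · intro h
    have ht2 : (1 - q) * ‖t / 2‖ < 1 := by
      rw [norm_div, Complex.norm_ofNat]
      rw [lt_div_iff₀ hc] at h1
      linarith
    have hd := (psConv_qBernoulliDenom hq0 hq1 ht2).2
    rw [← X_mul_qBernoulliDenomDivX,
      psEval_mul (psConv_X t) (psConv_qBernoulliDenomDivX hq0 hq1 h1), h, mul_zero] at hd
    have := firstZeroBesselTwo_le hq0 hq1 ht0 ht2 (sub_eq_zero.1 hd.symm)
    rw [lt_div_iff₀ hc] at h2
    linarith

/-- The generating function of the `q`-Bernoulli polynomials converges on the disc up to the first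
zero of `e_q(t/2) E_q(t/2) - 1`. -/
lemma psConv_qBernoulliGen {q : ℝ} (hq0 : 0 < q) (hq1 : q < 1) (z : ℂ) {t : ℂ}
    (ht : ‖t‖ < min (2 / (1 - q)) (firstZeroBesselTwo (1 / 2) q / (1 - q))) :
    PSConv (qBernoulliGen q z) t :=
  (psConv_rescale.2 (psConv_qExpBig hq0 hq1 _)).mul
    (psConv_inv (fun _ hs => psConv_qBernoulliDenomDivX hq0 hq1 (lt_min_iff.1 hs).1)
      (fun _ hs => psEval_qBernoulliDenomDivX_ne_zero hq0 hq1 hs) ht)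

lemma qBernoulliGen_mul {q : ℝ} (hq1 : q < 1) (z : ℂ) :
    qBernoulliGen q z * qBernoulliDenomDivX q = PowerSeries.rescale z (qExpBig q) := by
  rw [qBernoulliGen, mul_assoc, PowerSeries.inv_mul_cancel, mul_one]
  rw [constantCoeff_qBernoulliDenomDivX hq1]
  exact one_ne_zero

/-! ### Growth bound, rearrangement and the expansion -/

lemma qPsi_pos {q : ℝ} (hq0 : 0 < q) (hq1 : q < 1) (n : ℕ) : 0 < qPsi q n :=
  div_pos (pow_pos hq0 _) (qFact_pos hq0 hq1 n)

lemma coeff_qExpBig {q : ℝ} (hq1 : q < 1) (n : ℕ) :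
    PowerSeries.coeff n (qExpBig q) = (qPsi q n : ℂ) := by
  rw [qExpBig, PowerSeries.coeff_mk, qPsi, qFact_eq hq1, div_div_eq_mul_div]

lemma qBernoulliCoeffTerm_eq {q : ℝ} (hq0 : 0 < q) (hq1 : q < 1) (a : ℕ → ℂ) (n m : ℕ) :
    qBernoulliCoeffTerm q a n m =
    (((1 - q) ^ n : ℝ) : ℂ) *
      (a (n + m) / (qPsi q (n + m) : ℂ) * PowerSeries.coeff m (qBernoulliDenomDivX q)) := by
  have hc : 1 - q ≠ 0 := (sub_pos.2 hq1).ne'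
  have hq2 : q ^ 2 < 1 := pow_lt_one₀ hq0.le hq1 two_ne_zero
  have h3 := (qPoch_pos hq0 hq1 hq2 m).ne'
  have h4 := (qPoch_pos hq0 hq1 hq1 (n + m)).ne'
  have hreal : (q ^ ((n + m) * (n + m - 1) / 2))⁻¹ * qPoch q q (n + m) *
      qPoch (-q) q m * (1 / 2) ^ m / qPoch (q ^ 2) q m =
      (1 - q) ^ n * ((qPsi q (n + m))⁻¹ *
        (qPoch (-q) q m / qPoch (q ^ 2) q m * ((1 - q) / 2) ^ m)) := by
    rw [qPsi, qFact_eq hq1, div_pow, div_pow, pow_add (1 - q)]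
    field_simp
    simp
  rw [qBernoulliCoeffTerm, coeff_qBernoulliDenomDivX hq0 hq1, hreal]
  push_cast
  ring

/-- The root bound holds eventually; the constant `C` absorbs the finitely many remaining indices,
among them `n = 0`, where `1/n` is `0`. -/
lemma exists_norm_le_mul_pow {u : ℕ → ℂ} {τ r : ℝ} (hr : 0 < r) (hτ : τ < r)
    (h : Tendsto (fun n : ℕ => ‖u n‖ ^ (1 / (n : ℝ))) atTop (𝓝 τ)) :
    ∃ C : ℝ, ∀ n, ‖u n‖ ≤ C * r ^ n := by
  have hev : u =O[atTop] fun n => r ^ n := by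
    refine Asymptotics.IsBigO.of_bound 1 ?_
    filter_upwards [h.eventually_lt_const hτ, eventually_ge_atTop 1] with n hn hn1
    have hn0 : (n : ℝ) ≠ 0 := by exact_mod_cast (by omega : n ≠ 0)
    rw [one_mul, Real.norm_eq_abs, abs_of_pos (pow_pos hr n)]
    calc ‖u n‖ = (‖u n‖ ^ (1 / (n : ℝ))) ^ n := by
          rw [← Real.rpow_natCast, ← Real.rpow_mul (norm_nonneg _), one_div_mul_cancel hn0,
            Real.rpow_one]
      _ ≤ r ^ n := pow_le_pow_left₀ (Real.rpow_nonneg (norm_nonneg _) _) hn.le n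
  obtain ⟨C, hC0, hC⟩ := Asymptotics.bound_of_isBigO_nat_atTop hev
  refine ⟨C, fun n => ?_⟩
  have := hC (x := n) (pow_pos hr n).ne'
  rwa [Real.norm_eq_abs, abs_of_pos (pow_pos hr n)] at this

/-- Rearrangement of `∑_k u_k ∑_{n+m=k} b_n d_m` for a geometrically bounded sequence `u`. -/
lemma summable_mul_coeff_mul_coeff {u : ℕ → ℂ} {C r : ℝ} (hr : 0 ≤ r)
    (hu : ∀ n, ‖u n‖ ≤ C * r ^ n) {B D : PowerSeries ℂ} (hB : PSConv B r) (hD : PSConv D r) :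
    Summable fun p : ℕ × ℕ =>
      u (p.1 + p.2) * (PowerSeries.coeff p.1 B * PowerSeries.coeff p.2 D) := by
  have hs : Summable fun p : ℕ × ℕ => C * (‖PowerSeries.coeff p.1 B * (r : ℂ) ^ p.1‖ *
      ‖PowerSeries.coeff p.2 D * (r : ℂ) ^ p.2‖) :=
    (Summable.mul_of_nonneg hB hD (fun _ => norm_nonneg _) (fun _ => norm_nonneg _)).mul_left C
  refine Summable.of_norm_bounded hs fun p => ?_
  have hrn : ‖(r : ℂ)‖ = r := by simp [abs_of_nonneg hr]
  simp only [norm_mul, norm_pow, hrn]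
  calc _ ≤ (C * r ^ (p.1 + p.2)) * (‖PowerSeries.coeff p.1 B‖ * ‖PowerSeries.coeff p.2 D‖) := by
        gcongr
        exact hu _
    _ = _ := by ring

/-- An absolutely summable double family has the same sum along rows as along antidiagonals. -/
lemma hasSum_mul_tsum_of_antidiagonal {u : ℕ → ℂ} {B D P : PowerSeries ℂ} {s : ℂ}
    (hP : B * D = P) (hsum : Summable fun p : ℕ × ℕ =>
      u (p.1 + p.2) * (PowerSeries.coeff p.1 B * PowerSeries.coeff p.2 D))
    (hs : HasSum (fun k => u k * PowerSeries.coeff k P) s) :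
    HasSum (fun n => ∑' m, u (n + m) * (PowerSeries.coeff n B * PowerSeries.coeff m D)) s := by
  have h1 := hsum.hasSum.prod_fiberwise fun n => (hsum.prod_factor n).hasSum
  have h2 := (Finset.HasAntidiagonal.sigmaAntidiagonalEquivProd (A := ℕ)).hasSum_iff.2 hsum.hasSum
  have h3 := h2.sigma (g := fun k => u k * PowerSeries.coeff k P) fun k => by
    rw [← hP, PowerSeries.coeff_mul, Finset.mul_sum, ← Finset.sum_coe_sort]
    convert hasSum_fintype _ using 1
    refine Finset.sum_congr rfl fun c _ => ?_
    have := Finset.HasAntidiagonal.mem_antidiagonal.1 c.2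
    simp [this]
  rw [hs.unique h3]
  exact h1

theorem corollary4p7 (q : ℝ) (hq0 : 0 < q) (hq1 : q < 1)
    (f : ℂ → ℂ) (a : ℕ → ℂ) (hf : ∀ z : ℂ, HasSum (fun n : ℕ => a n * z ^ n) (f z))
    (τ : ℝ) (hτ0 : 0 ≤ τ)
    (hτ1 : τ < min (2 / (1 - q)) (firstZeroBesselTwo (1 / 2) q / (1 - q)))
    (hgrowth : Tendsto (fun n : ℕ => ‖a n / (qPsi q n : ℂ)‖ ^ (1 / (n : ℝ))) atTop (𝓝 τ)) :
    (∀ n : ℕ, Summable (fun m : ℕ => qBernoulliCoeffTerm q a n m)) ∧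
    ∀ z : ℂ, HasSum (fun n : ℕ => qBernoulliCoeff q a n * (qBernoulli q n z / (qFact q n : ℂ)))
      (f z) := by
  obtain ⟨r, hτr, hrR⟩ := exists_between hτ1
  have hr : 0 < r := hτ0.trans_lt hτr
  have hrn : ‖(r : ℂ)‖ = r := by simp [abs_of_pos hr]
  obtain ⟨C, hC⟩ := exists_norm_le_mul_pow hr hτr hgrowth
  have hD : PSConv (qBernoulliDenomDivX q) r :=
    psConv_qBernoulliDenomDivX hq0 hq1 (by rw [hrn]; exact (lt_min_iff.1 hrR).1)
  constructor
  · intro n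
    -- With `X ^ n` in place of `G`, row `n` of the double family is `u_{n+m} d_m` itself, without
    -- the factor `b_n`, which may vanish.
    have hX := (summable_mul_coeff_mul_coeff hr.le hC
      (psConv_of_coeff_eq_zero (A := PowerSeries.X ^ n) (N := n + 1) (fun k hk => by
        rw [PowerSeries.coeff_X_pow, if_neg (by omega)]) r) hD).prod_factor n
    simp only [PowerSeries.coeff_X_pow_self, one_mul] at hX
    simp only [qBernoulliCoeffTerm_eq hq0 hq1]
    exact hX.mul_left _
  · intro z
    have hB : PSConv (qBernoulliGen q z) r :=
      psConv_qBernoulliGen hq0 hq1 z (by rw [hrn]; exact hrR)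
    have hs : HasSum (fun k => a k / (qPsi q k : ℂ) *
        PowerSeries.coeff k (PowerSeries.rescale z (qExpBig q))) (f z) := by
      convert hf z using 1
      funext k
      have hk : (qPsi q k : ℂ) ≠ 0 := by exact_mod_cast (qPsi_pos hq0 hq1 k).ne'
      rw [PowerSeries.coeff_rescale, coeff_qExpBig hq1]
      field_simp
    have h := hasSum_mul_tsum_of_antidiagonal (u := fun k => a k / (qPsi q k : ℂ))
      (qBernoulliGen_mul hq1 z) (summable_mul_coeff_mul_coeff hr.le hC hB hD) hs
    have hterm : ∀ n, qBernoulliCoeff q a n * (qBernoulli q n z / (qFact q n : ℂ)) =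
        ∑' m, a (n + m) / (qPsi q (n + m) : ℂ) * (PowerSeries.coeff n (qBernoulliGen q z) *
          PowerSeries.coeff m (qBernoulliDenomDivX q)) := by
      intro n
      have hfact : (qFact q n : ℂ) ≠ 0 := by exact_mod_cast (qFact_pos hq0 hq1 n).ne'
      have hc : (((1 - q) ^ n : ℝ) : ℂ) ≠ 0 := by
        exact_mod_cast (pow_pos (sub_pos.2 hq1) n).ne'
      rw [qBernoulliCoeff, qBernoulli, mul_div_cancel_left₀ _ hfact, mul_comm]
      simp only [qBernoulliCoeffTerm_eq hq0 hq1]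
      rw [tsum_mul_left, Complex.ofReal_inv, inv_mul_cancel_left₀ hc, ← tsum_mul_left]
      exact tsum_congr fun m => by ring
    simpa only [hterm] using h

end
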